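/- Let $\mathcal H$ be a complex separable Hilbert space with an orthogonal decomposition $\mathcal H=\mathcal H_+\oplus\mathcal H_-$ into two infinite-dimensional closed subspaces, let $\mathrm{pr}_\pm$ be the orthogonal projections onto $\mathcal H_\pm$, and put $d=i(\mathrm{pr}_+-\mathrm{pr}_-)$. For a real number $p\ge 1$ and Hilbert spaces $\mathcal H_1,\mathcal H_2$ let $L_p(\mathcal H_1,\mathcal H_2)$ be the Schatten class of bounded operators $A\colon\mathcal H_1\to\mathcal H_2$ with $\mathrm{Tr}\,(A^*A)^{p/2}<\infty$. Write $\mathrm U(\mathcal K)$ for the group of unitary operators of a Hilbert space $\mathcal K$, and let $$\mathrm U_{\mathrm{res},p}(\mathcal H)=\{u\in \mathrm U(\mathcal H)\mid [d,u]\in L_p(\mathcal H)\}.$$ Let $\mathrm{Gr}_{\mathrm{res},p}(\mathcal H)$ be the set of all closed subspaces $V\subseteq\mathcal H$ such that $\mathrm{pr}_+|_V\colon V\to\mathcal H_+$ is Fredholm and $\mathrm{pr}_-|_V\colon V\to\mathcal H_-$ is of class $L_p$. **Proposition.** Let $1<p\le 2$. Then $\mathrm U_{\mathrm{res},p}(\mathcal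 H)$ is a subgroup of $\mathrm U(\mathcal H)$, it acts on $\mathrm{Gr}_{\mathrm{res},p}(\mathcal H)$ by $(u,V)\mapsto u(V)$, and this action is transitive. Moreover $\mathcal H_+\in\mathrm{Gr}_{\mathrm{res},p}(\mathcal H)$, and the stabilizer of $\mathcal H_+$ is $\mathrm U(\mathcal H_+)\times\mathrm U(\mathcal H_-)$, the group of all block-diagonal unitaries $a\oplus b$ with $a\in\mathrm U(\mathcal H_+)$ and $b\in\mathrm U(\mathcal H_-)$. -/

import Mathlib

open scoped ENNReal

section SchattenClass

theorem ofReal_inner_mul_self_eq {H κ : Type*} [NormedAddCommGroup H] [InnerProductSpace ℂ H]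
    (c : HilbertBasis κ ℂ H) {S : H →L[ℂ] H}
    (hS : ∀ x y : H, inner ℂ (S x) y = inner ℂ x (S y)) (x : H) :
    ENNReal.ofReal (inner ℂ x ((S * S) x)).re =
      ∑' j, ENNReal.ofReal (‖inner ℂ (c j) (S x)‖ ^ 2) := by
  have h1 : inner ℂ x ((S * S) x) = inner ℂ (S x) (S x) := by
    rw [hS]; rfl
  have h3 := Complex.hasSum_re (c.hasSum_inner_mul_inner (S x) (S x))
  have h4 : ∀ j, (inner ℂ (S x) (c j) * inner ℂ (c j) (S x) : ℂ).re =
      ‖inner ℂ (c j) (S x)‖ ^ 2 := by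
    intro j
    rw [← inner_conj_symm (S x) (c j), Complex.conj_mul']
    norm_cast
  simp only [h4] at h3
  rw [h1, ← h3.tsum_eq, ENNReal.ofReal_tsum_of_nonneg (fun _ => by positivity) h3.summable]

variable {H : Type*} [NormedAddCommGroup H] [InnerProductSpace ℂ H] [CompleteSpace H]
variable {K : Type*} [NormedAddCommGroup K] [InnerProductSpace ℂ K] [CompleteSpace K]

/-- The trace `∑ ⟨e, T e⟩ ∈ [0, ∞]` of a positive bounded operator `T`, computed in some Hilbert
basis of `H`. By `positiveTrace_eq` below the value does not depend on the basis. -/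
noncomputable def positiveTrace (T : H →L[ℂ] H) : ℝ≥0∞ :=
  ∑' e : (exists_hilbertBasis ℂ H).choose, ENNReal.ofReal (inner ℂ (e : H) (T e)).re

theorem tsum_ofReal_inner_eq {ι κ : Type*} (b : HilbertBasis ι ℂ H) (c : HilbertBasis κ ℂ H)
    {T : H →L[ℂ] H} (hT : 0 ≤ T) :
    ∑' i, ENNReal.ofReal (inner ℂ (b i) (T (b i))).re =
      ∑' j, ENNReal.ofReal (inner ℂ (c j) (T (c j))).re := by
  have hS : IsSelfAdjoint (CFC.sqrt T) := (CFC.sqrt_nonneg T).isSelfAdjoint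
  have hSS : CFC.sqrt T * CFC.sqrt T = T := CFC.sqrt_mul_sqrt_self T hT
  generalize CFC.sqrt T = S at hS hSS
  have hadj : ∀ x y : H, inner ℂ (S x) y = inner ℂ x (S y) := fun x y => by
    rw [← ContinuousLinearMap.adjoint_inner_right, ← ContinuousLinearMap.star_eq_adjoint,
      hS.star_eq]
  subst hSS
  rw [tsum_congr fun i => ofReal_inner_mul_self_eq c hadj (b i),
    tsum_congr fun j => ofReal_inner_mul_self_eq b hadj (c j), ENNReal.tsum_comm]
  refine tsum_congr fun j => tsum_congr fun i => ?_
  rw [← hadj, norm_inner_symm]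

theorem positiveTrace_eq {ι : Type*} (b : HilbertBasis ι ℂ H) {T : H →L[ℂ] H} (hT : 0 ≤ T) :
    positiveTrace T = ∑' i, ENNReal.ofReal (inner ℂ (b i) (T (b i))).re := by
  obtain ⟨c, hc⟩ := (exists_hilbertBasis ℂ H).choose_spec
  rw [tsum_ofReal_inner_eq b c hT, hc, positiveTrace]

/-- `A ∈ L_p(H, K)`: the trace of `(A* A) ^ (p / 2)` is finite. -/
def IsSchatten (p : ℝ) (A : H →L[ℂ] K) : Prop :=
  positiveTrace ((ContinuousLinearMap.adjoint A ∘L A) ^ (p / 2)) < ∞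

end SchattenClass

section Restricted

variable {H : Type*} [NormedAddCommGroup H] [InnerProductSpace ℂ H] [CompleteSpace H]

instance ClosedSubmodule.completeSpace_toSubmodule (V : ClosedSubmodule ℂ H) :
    CompleteSpace V.toSubmodule :=
  V.isClosed.completeSpace_coe

/-- The operator `d = i (pr₊ - pr₋)` of the polarization `H = H₊ ⊕ H₋`, where `H₋ = H₊ᗮ`. -/
noncomputable def polarizationOp (Hp : ClosedSubmodule ℂ H) : H →L[ℂ] H :=
  Complex.I • (Hp.toSubmodule.starProjection - Hp.orthogonal.toSubmodule.starProjection)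

/-- The set `U_{res,p}(H)` of unitaries `u` with `[d, u] ∈ L_p(H)`. -/
def restrictedUnitary (p : ℝ) (Hp : ClosedSubmodule ℂ H) : Set (unitary (H →L[ℂ] H)) :=
  {u | IsSchatten p (polarizationOp Hp * (u : H →L[ℂ] H) - (u : H →L[ℂ] H) * polarizationOp Hp)}

/-- The orthogonal projection onto `W`, restricted to `V`, as an operator `V → W`. -/
noncomputable def projRestrict (V W : ClosedSubmodule ℂ H) : V.toSubmodule →L[ℂ] W.toSubmodule :=
  W.toSubmodule.orthogonalProjectionOnto ∘L V.toSubmodule.subtypeL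

/-- The restricted Grassmannian `Gr_{res,p}(H)`: closed subspaces `V` such that `pr₊|V : V → H₊`
is Fredholm and `pr₋|V : V → H₋` is of class `L_p`. -/
def restrictedGrassmannian (p : ℝ) (Hp : ClosedSubmodule ℂ H) : Set (ClosedSubmodule ℂ H) :=
  {V | (projRestrict V Hp).IsFredholm ∧ IsSchatten p (projRestrict V Hp.orthogonal)}

end Restricted

/-! ### Traces of positive operators -/

section Trace

open ContinuousLinearMap

variable {H : Type*} [NormedAddCommGroup H] [InnerProductSpace ℂ H] [CompleteSpace H]
variable {K : Type*} [NormedAddCommGroup K] [InnerProductSpace ℂ K] [CompleteSpace K]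

/-! Write P for the projection onto H₊ and P_V for that onto V. Both conditions concern differences
of projections: V lies in the Grassmannian iff P_V - P ∈ L_p (`mem_restrictedGrassmannian_iff`), and
u is restricted iff u P u* - P ∈ L_p (`mem_restrictedUnitary_iff`). Since P_{uV} = u P_V u*, for V
in the Grassmannian u is restricted iff uV is again in it. The group laws and the action follow, and
so does transitivity: V, W and their complements are infinite-dimensional and separable, so some
unitary carries V to W, and it is automatically restricted. A unitary fixing H₊ commutes with P,
hence is block diagonal.

This needs L_p to be a two-sided ideal closed under adjoints. With q = p/2 ≤ 1, that follows from
operator monotonicity of t^q together with Tr (X+Y)^q ≤ Tr X^q + Tr Y^q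
(`positiveTrace_rpow_add_le`) and Tr (AA*)^q ≤ Tr (A*A)^q
(`positiveTrace_rpow_self_comp_adjoint_le`), both obtained by replacing X^q with X (X+ε)^(q-1) and
letting ε → 0. The Fredholm condition turns into an L_p condition (`isFredholm_projRestrict_iff`)
because L_p operators are Hilbert–Schmidt, so g*g is a norm limit of finite-rank operators when g ∈
L_p. -/

theorem positiveTrace_mono {S T : H →L[ℂ] H} (h : S ≤ T) : positiveTrace S ≤ positiveTrace T := by
  refine ENNReal.tsum_le_tsum fun e => ENNReal.ofReal_le_ofReal ?_
  have := (ContinuousLinearMap.le_def S T |>.mp h).re_inner_nonneg_right (e : H)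
  simp only [sub_apply, inner_sub_right, map_sub, sub_nonneg] at this
  exact this

theorem positiveTrace_add {S T : H →L[ℂ] H} (hS : 0 ≤ S) (hT : 0 ≤ T) :
    positiveTrace (S + T) = positiveTrace S + positiveTrace T := by
  rw [positiveTrace, positiveTrace, positiveTrace, ← ENNReal.tsum_add]
  refine tsum_congr fun e => ?_
  have h1 : 0 ≤ (inner ℂ (e : H) (S e)).re :=
    ((nonneg_iff_isPositive S).mp hS).re_inner_nonneg_right (e : H)
  have h2 : 0 ≤ (inner ℂ (e : H) (T e)).re :=
    ((nonneg_iff_isPositive T).mp hT).re_inner_nonneg_right (e : H)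
  rw [← ENNReal.ofReal_add h1 h2, add_apply, inner_add_right, Complex.add_re]

theorem positiveTrace_zero : positiveTrace (0 : H →L[ℂ] H) = 0 := by simp [positiveTrace]

theorem adjoint_comp_self_nonneg (A : H →L[ℂ] K) : 0 ≤ adjoint A ∘L A :=
  (nonneg_iff_isPositive _).mpr (isPositive_adjoint_comp_self A)

theorem self_comp_adjoint_nonneg (A : H →L[ℂ] K) : 0 ≤ A ∘L adjoint A :=
  (nonneg_iff_isPositive _).mpr (isPositive_self_comp_adjoint A)

theorem re_inner_adjoint_comp_self (A : H →L[ℂ] K) (x : H) :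
    (inner ℂ x ((adjoint A ∘L A) x)).re = ‖A x‖ ^ 2 := by
  rw [comp_apply, adjoint_inner_right]
  exact inner_self_eq_norm_sq (𝕜 := ℂ) (A x)

theorem HilbertBasis.ofReal_norm_sq_eq_tsum {H ι : Type*} [NormedAddCommGroup H]
    [InnerProductSpace ℂ H] (c : HilbertBasis ι ℂ H) (x : H) :
    ENNReal.ofReal (‖x‖ ^ 2) = ∑' j, ENNReal.ofReal (‖inner ℂ (c j) x‖ ^ 2) := by
  have := ofReal_inner_mul_self_eq c (S := 1) (fun _ _ => rfl) x
  rw [mul_one] at this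
  refine Eq.trans ?_ this
  congr 1
  exact (inner_self_eq_norm_sq (𝕜 := ℂ) x).symm

theorem positiveTrace_adjoint_comp_self {ι : Type*} (b : HilbertBasis ι ℂ H) (A : H →L[ℂ] K) :
    positiveTrace (adjoint A ∘L A) = ∑' i, ENNReal.ofReal (‖A (b i)‖ ^ 2) := by
  rw [positiveTrace_eq b (adjoint_comp_self_nonneg A)]
  simp only [re_inner_adjoint_comp_self]

/-- Both sides are the double sum of |⟨c_j, A b_i⟩|², taken in either order. -/
theorem positiveTrace_comm (A : H →L[ℂ] K) :
    positiveTrace (adjoint A ∘L A) = positiveTrace (A ∘L adjoint A) := by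
  obtain ⟨_, b, -⟩ := exists_hilbertBasis ℂ H
  obtain ⟨_, c, -⟩ := exists_hilbertBasis ℂ K
  have h := positiveTrace_adjoint_comp_self c (adjoint A)
  rw [adjoint_adjoint] at h
  rw [positiveTrace_adjoint_comp_self b, h]
  simp only [c.ofReal_norm_sq_eq_tsum, b.ofReal_norm_sq_eq_tsum]
  rw [ENNReal.tsum_comm]
  refine tsum_congr fun j => tsum_congr fun i => ?_
  rw [← adjoint_inner_left, norm_inner_symm]

/-- Lower semicontinuity: the trace is a supremum of finite partial sums, each norm-continuous. -/
theorem positiveTrace_le_of_tendsto {α : Type*} {l : Filter α} [l.NeBot] {F : α → H →L[ℂ] H}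
    {T : H →L[ℂ] H} (hF : Filter.Tendsto F l (nhds T)) {c : ℝ≥0∞}
    (hc : ∀ᶠ i in l, positiveTrace (F i) ≤ c) : positiveTrace T ≤ c := by
  rw [positiveTrace, ENNReal.tsum_eq_iSup_sum]
  refine iSup_le fun s => ?_
  refine le_of_tendsto (f := fun i => ∑ e ∈ s, ENNReal.ofReal (inner ℂ (e : H) (F i e)).re)
    (x := l) ?_ ?_
  · refine tendsto_finsetSum _ fun e _ => ENNReal.tendsto_ofReal ?_
    have h : Continuous fun G : H →L[ℂ] H => (inner ℂ (e : H) (G e)).re := by fun_prop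
    exact (h.tendsto T).comp hF
  · filter_upwards [hc] with i hi
    exact (ENNReal.sum_le_tsum s).trans hi

end Trace

/-! ### The regularization X (X + ε)^(q-1) of X^q -/

section RegularizedPower

variable {A : Type*} [CStarAlgebra A] [PartialOrder A] [StarOrderedRing A]

/-- The regularization `(X + ε) ^ (q - 1)` of the power `X ^ (q - 1)`. -/
noncomputable def regPow (q ε : ℝ) (X : A) : A := cfc (fun t : ℝ => (t + ε) ^ (q - 1)) X

theorem continuousOn_add_rpow (r : ℝ) {ε : ℝ} (hε : 0 < ε) :
    ContinuousOn (fun t : ℝ => (t + ε) ^ r) (Set.Ici 0) :=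
  ContinuousOn.rpow_const (by fun_prop) fun t ht => Or.inl (by
    have : (0 : ℝ) ≤ t := ht
    positivity)

theorem spectrum_subset_Ici {X : A} (hX : 0 ≤ X) : spectrum ℝ X ⊆ Set.Ici 0 :=
  fun _ ht => spectrum_nonneg_of_nonneg hX ht

theorem regPow_nonneg (q : ℝ) {ε : ℝ} (hε : 0 < ε) {X : A} (hX : 0 ≤ X) : 0 ≤ regPow q ε X :=
  cfc_nonneg fun t ht => by
    have : 0 ≤ t := spectrum_nonneg_of_nonneg hX ht
    positivity

theorem mul_regPow (q : ℝ) {ε : ℝ} (hε : 0 < ε) {X : A} (hX : 0 ≤ X) :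
    X * regPow q ε X = cfc (fun t : ℝ => t * (t + ε) ^ (q - 1)) X := by
  rw [cfc_mul (fun t : ℝ => t) _ X (by fun_prop)
    ((continuousOn_add_rpow _ hε).mono (spectrum_subset_Ici hX)), cfc_id' ℝ X]
  rfl

theorem commute_regPow (q ε : ℝ) {X : A} (hX : 0 ≤ X) : Commute X (regPow q ε X) := by
  have := cfc_commute_cfc (fun t : ℝ => t) (fun t : ℝ => (t + ε) ^ (q - 1)) X
  rwa [cfc_id' ℝ X] at this

theorem Real.mul_add_rpow_le {q t ε : ℝ} (hq : q ≤ 1) (hε : 0 < ε) (ht : 0 ≤ t) :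
    t * (t + ε) ^ (q - 1) ≤ t ^ q := by
  rcases ht.eq_or_lt with rfl | ht
  · rw [zero_mul]; positivity
  · calc t * (t + ε) ^ (q - 1) ≤ t * t ^ (q - 1) := by
          gcongr t * ?_
          exact Real.rpow_le_rpow_of_nonpos ht (by linarith) (by linarith)
      _ = t ^ q := by rw [Real.rpow_sub_one ht.ne']; field_simp

/-- Replacing t^q by (t+ε)^q leaves ε (t+ε)^(q-1), which is largest at t = 0. The bound is uniform
in t, whence norm convergence in `tendsto_mul_regPow`. -/
theorem Real.rpow_sub_mul_add_rpow_le {q t ε : ℝ} (hq : 0 < q) (hε : 0 < ε) (hq1 : q ≤ 1)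
    (ht : 0 ≤ t) : t ^ q - t * (t + ε) ^ (q - 1) ≤ ε ^ q := by
  have h1 : t ^ q ≤ (t + ε) ^ q := Real.rpow_le_rpow ht (by linarith) hq.le
  have h2 : (t + ε) ^ q = (t + ε) * (t + ε) ^ (q - 1) := by
    rw [Real.rpow_sub_one (by positivity)]; field_simp
  have h3 : ε * (t + ε) ^ (q - 1) ≤ ε * ε ^ (q - 1) := by
    gcongr ε * ?_
    exact Real.rpow_le_rpow_of_nonpos hε (by linarith) (by linarith)
  have h4 : ε * ε ^ (q - 1) = ε ^ q := by
    rw [Real.rpow_sub_one hε.ne']; field_simp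
  linarith

theorem continuousOn_mul_add_rpow (r : ℝ) {ε : ℝ} (hε : 0 < ε) :
    ContinuousOn (fun t : ℝ => t * (t + ε) ^ r) (Set.Ici 0) :=
  continuousOn_id.mul (continuousOn_add_rpow r hε)

theorem mul_regPow_le {q ε : ℝ} (hq : 0 < q) (hq1 : q ≤ 1) (hε : 0 < ε) {X : A} (hX : 0 ≤ X) :
    X * regPow q ε X ≤ X ^ q := by
  rw [mul_regPow q hε hX, CFC.rpow_eq_cfc_real hX]
  refine cfc_mono (fun t ht => Real.mul_add_rpow_le hq1 hε (spectrum_nonneg_of_nonneg hX ht)) ?_ ?_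
  · exact (continuousOn_mul_add_rpow _ hε).mono (spectrum_subset_Ici hX)
  · exact (Real.continuous_rpow_const hq.le).continuousOn

theorem tendsto_mul_regPow {q : ℝ} (hq : 0 < q) (hq1 : q ≤ 1) {X : A} (hX : 0 ≤ X) :
    Filter.Tendsto (fun ε : ℝ => X * regPow q ε X) (nhdsWithin 0 (Set.Ioi 0)) (nhds (X ^ q)) := by
  rw [tendsto_iff_norm_sub_tendsto_zero]
  have h0 : Filter.Tendsto (fun ε : ℝ => ε ^ q) (nhdsWithin 0 (Set.Ioi 0)) (nhds 0) := by
    have := (Real.continuous_rpow_const hq.le).tendsto 0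
    rw [Real.zero_rpow hq.ne'] at this
    exact this.mono_left nhdsWithin_le_nhds
  refine squeeze_zero' (Filter.Eventually.of_forall fun _ => norm_nonneg _) ?_ h0
  filter_upwards [self_mem_nhdsWithin] with ε (hε : 0 < ε)
  rw [mul_regPow q hε hX, CFC.rpow_eq_cfc_real hX, ← cfc_sub _ _ X
    ((continuousOn_mul_add_rpow _ hε).mono (spectrum_subset_Ici hX))
    (Real.continuous_rpow_const hq.le).continuousOn]
  refine norm_cfc_le (by positivity) fun t ht => ?_
  have ht : 0 ≤ t := spectrum_nonneg_of_nonneg hX ht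
  rw [Real.norm_eq_abs, abs_sub_comm, abs_of_nonneg (sub_nonneg.mpr
    (Real.mul_add_rpow_le hq1 hε ht))]
  exact Real.rpow_sub_mul_add_rpow_le hq hε hq1 ht

theorem regPow_eq_rpow (q : ℝ) {ε : ℝ} (hε : 0 < ε) {X : A} (hX : 0 ≤ X) :
    regPow q ε X = (X + algebraMap ℝ A ε) ^ (q - 1) := by
  have h : X + algebraMap ℝ A ε = cfc (fun t : ℝ => t + ε) X := by
    rw [cfc_add_const ε (fun t : ℝ => t) X, cfc_id' ℝ X]
  rw [h, CFC.cfc_rpow (fun t ht => by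
    have : 0 ≤ t := spectrum_nonneg_of_nonneg hX ht
    positivity)]
  rfl

/-- For q < 1, (X+ε)^(q-1) is the inverse of (X+ε)^(1-q): the latter is operator monotone by
Löwner–Heinz, and inversion reverses order. -/
theorem regPow_antitone {q : ℝ} (hq : 0 ≤ q) (hq1 : q ≤ 1) {ε : ℝ} (hε : 0 < ε) {X Y : A}
    (hX : 0 ≤ X) (hXY : X ≤ Y) : regPow q ε Y ≤ regPow q ε X := by
  have hpos : ∀ Z : A, 0 ≤ Z → IsStrictlyPositive (Z + algebraMap ℝ A ε) := by
    intro Z hZ; grind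
  have hX' := hpos X hX
  have hY' := hpos Y (hX.trans hXY)
  rw [regPow_eq_rpow q hε hX, regPow_eq_rpow q hε (hX.trans hXY)]
  rcases hq1.eq_or_lt with rfl | hq1
  · rw [sub_self, CFC.rpow_zero _ hX'.nonneg, CFC.rpow_zero _ hY'.nonneg]
  · have hexp : ∀ Z : A, IsStrictlyPositive Z → Z ^ (q - 1) = (Z ^ (1 - q)) ^ (-1 : ℝ) := by
      intro Z hZ
      rw [CFC.rpow_rpow Z _ _ (by linarith) hZ]
      ring_nf
    rw [hexp _ hX', hexp _ hY']
    refine CStarAlgebra.rpow_neg_one_le_rpow_neg_one ?_ ?_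
    · exact CFC.rpow_le_rpow ⟨by linarith, by linarith⟩ (add_le_add_left hXY _)
    · exact IsStrictlyPositive.iff_of_unital.mpr
        ⟨CFC.rpow_nonneg, hX'.isUnit.cfcRpow _ hX'.nonneg⟩

theorem norm_cfc_sub_aeval_le {Z : A} {R δ : ℝ} (hδ : 0 ≤ δ) {f : ℝ → ℝ}
    (hf : ContinuousOn f (Set.Ici 0)) {P : Polynomial ℝ}
    (hP : ∀ t ∈ Set.Icc 0 R, |P.eval t - f t| < δ) (hZ : 0 ≤ Z)
    (hs : spectrum ℝ Z ⊆ Set.Icc 0 R) : ‖cfc f Z - Polynomial.aeval Z P‖ ≤ δ := by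
  rw [← cfc_polynomial P Z, ← cfc_sub f _ Z (hf.mono fun t ht => (hs ht).1)]
  refine norm_cfc_le hδ fun t ht => ?_
  rw [Real.norm_eq_abs, abs_sub_comm]
  exact (hP t (hs ht)).le

end RegularizedPower

/-! ### Functional calculus of intertwined operators -/

section Intertwining

open ContinuousLinearMap

variable {H : Type*} [NormedAddCommGroup H] [InnerProductSpace ℂ H] [CompleteSpace H]
variable {K : Type*} [NormedAddCommGroup K] [InnerProductSpace ℂ K] [CompleteSpace K]

theorem comp_aeval_of_intertwines {H K : Type*} [NormedAddCommGroup H] [InnerProductSpace ℂ H]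
    [NormedAddCommGroup K] [InnerProductSpace ℂ K] {A : H →L[ℂ] K} {X : H →L[ℂ] H} {Y : K →L[ℂ] K}
    (h : A ∘L X = Y ∘L A) (P : Polynomial ℝ) :
    A ∘L Polynomial.aeval X P = Polynomial.aeval Y P ∘L A := by
  induction P using Polynomial.induction_on' with
  | add p q hp hq => rw [map_add, map_add, comp_add, add_comp, hp, hq]
  | monomial n a =>
    have hpow : A ∘L (X ^ n) = (Y ^ n) ∘L A := by
      induction n with
      | zero => rfl
      | succ n ih =>
        rw [pow_succ, pow_succ']
        calc A ∘L (X ^ n * X) = (A ∘L (X ^ n)) ∘L X := rfl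
          _ = (Y ^ n) ∘L (A ∘L X) := by rw [ih]; rfl
          _ = (Y ^ n * Y) ∘L A := by rw [h]; rfl
          _ = _ := by rw [← pow_succ, pow_succ']
    ext x
    have := congr($hpow x)
    simp only [comp_apply] at this
    simpa [Polynomial.aeval_monomial, Algebra.algebraMap_eq_smul_one] using congrArg (a • ·) this

/-- Polynomials respect the intertwining; Weierstrass approximation on an interval containing both
spectra extends this to continuous functions. -/
theorem comp_cfc_of_intertwines {A : H →L[ℂ] K} {X : H →L[ℂ] H} {Y : K →L[ℂ] K}
    (hX : 0 ≤ X) (hY : 0 ≤ Y) (h : A ∘L X = Y ∘L A) {f : ℝ → ℝ}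
    (hf : ContinuousOn f (Set.Ici 0)) : A ∘L cfc f X = cfc f Y ∘L A := by
  obtain ⟨R, hR⟩ : ∃ R : ℝ, spectrum ℝ X ∪ spectrum ℝ Y ⊆ Set.Icc 0 R := by
    obtain ⟨R, hR⟩ := ((spectrum.isBounded (𝕜 := ℝ) X).union
      (spectrum.isBounded (𝕜 := ℝ) Y)).bddAbove
    refine ⟨R, fun t ht => ⟨?_, hR ht⟩⟩
    exact ht.elim (spectrum_nonneg_of_nonneg hX ·) (spectrum_nonneg_of_nonneg hY ·)
  rw [← sub_eq_zero, ← norm_le_zero_iff]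
  refine le_of_forall_pos_le_add fun δ hδ => ?_
  -- Each of the two error terms gets multiplied by ‖A‖; the +1 covers A = 0.
  obtain ⟨P, hP⟩ := exists_polynomial_near_of_continuousOn 0 R f
    (hf.mono Set.Icc_subset_Ici_self) (δ / (2 * (‖A‖ + 1))) (by positivity)
  have hX' := norm_cfc_sub_aeval_le (by positivity) hf hP hX (Set.subset_union_left.trans hR)
  have hY' := norm_cfc_sub_aeval_le (by positivity) hf hP hY (Set.subset_union_right.trans hR)
  have hsplit : A ∘L cfc f X - cfc f Y ∘L A =
      A ∘L (cfc f X - Polynomial.aeval X P) - (cfc f Y - Polynomial.aeval Y P) ∘L A := by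
    rw [comp_sub, sub_comp, comp_aeval_of_intertwines h]
    abel
  rw [hsplit, zero_add]
  calc _ ≤ ‖A‖ * (δ / (2 * (‖A‖ + 1))) + (δ / (2 * (‖A‖ + 1))) * ‖A‖ := by
        refine (norm_sub_le _ _).trans (add_le_add ?_ ?_)
        · exact (opNorm_comp_le _ _).trans (by gcongr)
        · exact (opNorm_comp_le _ _).trans (by gcongr)
    _ = δ * (‖A‖ / (‖A‖ + 1)) := by field_simp; ring
    _ ≤ δ * 1 := by
        gcongr
        rw [div_le_one (by positivity)]
        linarith
    _ = δ := mul_one δ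

end Intertwining

/-! ### Trace inequalities for powers q ≤ 1 -/

section TraceInequalities

open ContinuousLinearMap

variable {H : Type*} [NormedAddCommGroup H] [InnerProductSpace ℂ H] [CompleteSpace H]
variable {K : Type*} [NormedAddCommGroup K] [InnerProductSpace ℂ K] [CompleteSpace K]

/-- A form of Tr(ST) = Tr(TS) in which both operators are positive, so that `positiveTrace` is
meaningful. -/
theorem positiveTrace_conj_comm {S T : H →L[ℂ] H} (hS : 0 ≤ S) (hT : 0 ≤ T) :
    positiveTrace (CFC.sqrt S * T * CFC.sqrt S) = positiveTrace (CFC.sqrt T * S * CFC.sqrt T) := by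
  have hs : adjoint (CFC.sqrt S) = CFC.sqrt S := (CFC.sqrt_nonneg S).isSelfAdjoint.star_eq
  have ht : adjoint (CFC.sqrt T) = CFC.sqrt T := (CFC.sqrt_nonneg T).isSelfAdjoint.star_eq
  have h := positiveTrace_comm (CFC.sqrt T * CFC.sqrt S)
  have hadj : adjoint (CFC.sqrt T * CFC.sqrt S) = CFC.sqrt S * CFC.sqrt T := by
    rw [mul_def, adjoint_comp, hs, ht]; rfl
  rw [hadj] at h
  convert h using 2
  · nth_rw 1 [← CFC.sqrt_mul_sqrt_self T hT]
    rfl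
  · nth_rw 1 [← CFC.sqrt_mul_sqrt_self S hS]
    rfl

theorem sqrt_mul_mul_sqrt {S T : H →L[ℂ] H} (hS : 0 ≤ S) (h : Commute T S) :
    CFC.sqrt S * T * CFC.sqrt S = T * S := by
  have hc : Commute T (CFC.sqrt S) := by
    rw [CFC.sqrt_eq_cfc]
    exact (Commute.cfc_nnreal h.symm _).symm
  rw [← hc.eq, mul_assoc, CFC.sqrt_mul_sqrt_self S hS]

theorem conj_sqrt_nonneg {S T : H →L[ℂ] H} (hT : 0 ≤ T) : 0 ≤ CFC.sqrt S * T * CFC.sqrt S :=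
  IsSelfAdjoint.conjugate_nonneg hT (CFC.sqrt_nonneg S).isSelfAdjoint

theorem conj_sqrt_mono {R S T : H →L[ℂ] H} (h : S ≤ T) :
    CFC.sqrt R * S * CFC.sqrt R ≤ CFC.sqrt R * T * CFC.sqrt R :=
  IsSelfAdjoint.conjugate_le_conjugate h (CFC.sqrt_nonneg R).isSelfAdjoint

/-- Cyclicity moves X to the outside, so antitonicity can replace Z by X in the inner factor. -/
theorem positiveTrace_conj_regPow_le {q ε : ℝ} (hq : 0 < q) (hq1 : q ≤ 1) (hε : 0 < ε)
    {X Z : H →L[ℂ] H} (hX : 0 ≤ X) (hXZ : X ≤ Z) :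
    positiveTrace (CFC.sqrt (regPow q ε Z) * X * CFC.sqrt (regPow q ε Z)) ≤
      positiveTrace (X ^ q) := by
  rw [positiveTrace_conj_comm (regPow_nonneg q hε (hX.trans hXZ)) hX]
  calc _ ≤ positiveTrace (CFC.sqrt X * regPow q ε X * CFC.sqrt X) :=
        positiveTrace_mono (conj_sqrt_mono (regPow_antitone hq.le hq1 hε hX hXZ))
    _ = positiveTrace (X * regPow q ε X) := by
        rw [sqrt_mul_mul_sqrt hX (commute_regPow q ε hX).symm, (commute_regPow q ε hX).eq]
    _ ≤ _ := positiveTrace_mono (mul_regPow_le hq hq1 hε hX)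

/-- With Z = X + Y, the trace of Z (Z+ε)^(q-1) splits additively in the first factor, and each
summand is bounded separately. -/
theorem positiveTrace_rpow_add_le {q : ℝ} (hq : 0 < q) (hq1 : q ≤ 1) {X Y : H →L[ℂ] H}
    (hX : 0 ≤ X) (hY : 0 ≤ Y) :
    positiveTrace ((X + Y) ^ q) ≤ positiveTrace (X ^ q) + positiveTrace (Y ^ q) := by
  have hZ : 0 ≤ X + Y := add_nonneg hX hY
  refine positiveTrace_le_of_tendsto (tendsto_mul_regPow hq hq1 hZ) ?_
  filter_upwards [self_mem_nhdsWithin] with ε (hε : 0 < ε)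
  rw [← sqrt_mul_mul_sqrt (regPow_nonneg q hε hZ) (commute_regPow q ε hZ), mul_add, add_mul,
    positiveTrace_add (conj_sqrt_nonneg hX) (conj_sqrt_nonneg hY)]
  exact add_le_add (positiveTrace_conj_regPow_le hq hq1 hε hX (le_add_of_nonneg_right hY))
    (positiveTrace_conj_regPow_le hq hq1 hε hY (le_add_of_nonneg_left hX))

theorem positiveTrace_rpow_self_comp_adjoint_le {q : ℝ} (hq : 0 < q) (hq1 : q ≤ 1)
    (A : H →L[ℂ] K) :
    positiveTrace ((A ∘L adjoint A) ^ q) ≤ positiveTrace ((adjoint A ∘L A) ^ q) := by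
  have hX := adjoint_comp_self_nonneg A
  have hY := self_comp_adjoint_nonneg A
  refine positiveTrace_le_of_tendsto (tendsto_mul_regPow hq hq1 hY) ?_
  filter_upwards [self_mem_nhdsWithin] with ε (hε : 0 < ε)
  set X := adjoint A ∘L A with hXdef
  set Y := A ∘L adjoint A with hYdef
  set R := CFC.sqrt (regPow q ε X) with hR
  have hRR : R * R = regPow q ε X := CFC.sqrt_mul_sqrt_self _ (regPow_nonneg q hε hX)
  have hRadj : adjoint R = R := (CFC.sqrt_nonneg (regPow q ε X)).isSelfAdjoint.star_eq
  have hint : A ∘L regPow q ε X = regPow q ε Y ∘L A :=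
    comp_cfc_of_intertwines hX hY rfl (continuousOn_add_rpow _ hε)
  -- With R² = (X+ε)^(q-1), the two regularized powers are (AR)(AR)* and (AR)*(AR), which have equal
  -- trace.
  have h1 : Y * regPow q ε Y = (A ∘L R) ∘L adjoint (A ∘L R) := by
    rw [(commute_regPow q ε hY).eq, adjoint_comp, hRadj]
    calc regPow q ε Y * Y = (regPow q ε Y ∘L A) ∘L adjoint A := rfl
      _ = (A ∘L (R * R)) ∘L adjoint A := by rw [← hint, hRR]
      _ = _ := rfl
  have h2 : adjoint (A ∘L R) ∘L (A ∘L R) = X * regPow q ε X := by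
    rw [adjoint_comp, hRadj, ← sqrt_mul_mul_sqrt (regPow_nonneg q hε hX) (commute_regPow q ε hX)]
    rfl
  rw [h1, ← positiveTrace_comm, h2]
  exact positiveTrace_mono (mul_regPow_le hq hq1 hε hX)

end TraceInequalities

/-! ### Schatten operators as an ideal, and finite-rank approximation -/

section SchattenIdeal

open ContinuousLinearMap

variable {H : Type*} [NormedAddCommGroup H] [InnerProductSpace ℂ H] [CompleteSpace H]
variable {K : Type*} [NormedAddCommGroup K] [InnerProductSpace ℂ K] [CompleteSpace K]
variable {L : Type*} [NormedAddCommGroup L] [InnerProductSpace ℂ L] [CompleteSpace L]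
variable {p : ℝ}

theorem positiveTrace_smul {c : ℝ} (hc : 0 ≤ c) (T : H →L[ℂ] H) :
    positiveTrace (c • T) = ENNReal.ofReal c * positiveTrace T := by
  rw [positiveTrace, positiveTrace, ← ENNReal.tsum_mul_left]
  refine tsum_congr fun e => ?_
  rw [← ENNReal.ofReal_mul hc, smul_apply, inner_smul_right_eq_smul, Complex.smul_re, smul_eq_mul]

theorem positiveTrace_rpow_nsmul_lt_top {q : ℝ} (hq : 0 < q) (hq1 : q ≤ 1) {X : H →L[ℂ] H}
    (hX : 0 ≤ X) (h : positiveTrace (X ^ q) < ∞) (n : ℕ) : positiveTrace ((n • X) ^ q) < ∞ := by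
  induction n with
  | zero =>
    have h0 : (0 : H →L[ℂ] H) ^ q = 0 := CFC.zero_rpow hq.ne'
    rw [zero_smul, h0, positiveTrace_zero]
    exact ENNReal.zero_lt_top
  | succ n ih =>
    rw [succ_nsmul]
    exact (positiveTrace_rpow_add_le hq hq1 (nsmul_nonneg hX n) hX).trans_lt
      (ENNReal.add_lt_top.mpr ⟨ih, h⟩)

theorem le_of_re_inner_le {S T : H →L[ℂ] H} (hS : IsSelfAdjoint S) (hT : IsSelfAdjoint T)
    (h : ∀ x, (inner ℂ x (S x)).re ≤ (inner ℂ x (T x)).re) : S ≤ T := by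
  rw [le_def, isPositive_def']
  refine ⟨hT.sub hS, fun x => ?_⟩
  rw [reApplyInnerSelf_apply, ← inner_re_symm, sub_apply, inner_sub_right, map_sub, sub_nonneg]
  exact h x

/-- The hypothesis says B*B ≤ nX, and t^(p/2) is operator monotone. The constant is an integer so
that subadditivity, iterated, handles nX. -/
theorem IsSchatten.of_norm_sq_le (hp : 0 < p) (hp2 : p ≤ 2) {X : H →L[ℂ] H} (hX : 0 ≤ X)
    (hXp : positiveTrace (X ^ (p / 2)) < ∞) {B : H →L[ℂ] L} (n : ℕ)
    (h : ∀ x, ‖B x‖ ^ 2 ≤ n * (inner ℂ x (X x)).re) : IsSchatten p B := by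
  have hn : 0 ≤ n • X := nsmul_nonneg hX n
  have hle : ContinuousLinearMap.adjoint B ∘L B ≤ n • X := by
    refine le_of_re_inner_le (adjoint_comp_self_nonneg B).isSelfAdjoint hn.isSelfAdjoint
      fun x => ?_
    rw [re_inner_adjoint_comp_self]
    refine (h x).trans_eq ?_
    rw [← Nat.cast_smul_eq_nsmul ℝ, smul_apply, inner_smul_right_eq_smul, Complex.smul_re,
      smul_eq_mul]
  exact (positiveTrace_mono (CFC.rpow_le_rpow ⟨by linarith, by linarith⟩ hle)).trans_lt
    (positiveTrace_rpow_nsmul_lt_top (by linarith) (by linarith) hX hXp n)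

theorem IsSchatten.zero (hp : p ≠ 0) : IsSchatten p (0 : H →L[ℂ] K) := by
  have h0 : (0 : H →L[ℂ] H) ^ (p / 2) = 0 := CFC.zero_rpow (by simpa using hp)
  rw [IsSchatten, comp_zero, h0, positiveTrace_zero]
  exact ENNReal.zero_lt_top

theorem IsSchatten.adjoint (hp : 0 < p) (hp2 : p ≤ 2) {A : H →L[ℂ] K} (hA : IsSchatten p A) :
    IsSchatten p (adjoint A) := by
  rw [IsSchatten, adjoint_adjoint]
  exact (positiveTrace_rpow_self_comp_adjoint_le (by linarith) (by linarith) A).trans_lt hA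

theorem IsSchatten.comp_left (hp : 0 < p) (hp2 : p ≤ 2) {A : H →L[ℂ] K} (hA : IsSchatten p A)
    (B : K →L[ℂ] L) : IsSchatten p (B ∘L A) := by
  refine .of_norm_sq_le hp hp2 (adjoint_comp_self_nonneg A) hA ⌈‖B‖ ^ 2⌉₊ fun x => ?_
  rw [re_inner_adjoint_comp_self]
  calc ‖(B ∘L A) x‖ ^ 2 ≤ (‖B‖ * ‖A x‖) ^ 2 := by gcongr; exact B.le_opNorm (A x)
    _ = ‖B‖ ^ 2 * ‖A x‖ ^ 2 := mul_pow _ _ _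
    _ ≤ _ := by gcongr; exact Nat.le_ceil _

theorem IsSchatten.comp_right (hp : 0 < p) (hp2 : p ≤ 2) {A : K →L[ℂ] L} (hA : IsSchatten p A)
    (B : H →L[ℂ] K) : IsSchatten p (A ∘L B) := by
  have := ((hA.adjoint hp hp2).comp_left hp hp2 (ContinuousLinearMap.adjoint B)).adjoint hp hp2
  rwa [adjoint_comp, adjoint_adjoint, adjoint_adjoint] at this

theorem IsSchatten.smul (hp : 0 < p) (hp2 : p ≤ 2) {A : H →L[ℂ] K} (hA : IsSchatten p A)
    (c : ℂ) : IsSchatten p (c • A) := by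
  simpa using hA.comp_left hp hp2 (c • ContinuousLinearMap.id ℂ K)

theorem IsSchatten.neg (hp : 0 < p) (hp2 : p ≤ 2) {A : H →L[ℂ] K} (hA : IsSchatten p A) :
    IsSchatten p (-A) := by
  simpa using hA.smul hp hp2 (-1)

theorem IsSchatten.add (hp : 0 < p) (hp2 : p ≤ 2) {A B : H →L[ℂ] K} (hA : IsSchatten p A)
    (hB : IsSchatten p B) : IsSchatten p (A + B) := by
  have hA0 := adjoint_comp_self_nonneg A
  have hB0 := adjoint_comp_self_nonneg B
  refine .of_norm_sq_le hp hp2 (add_nonneg hA0 hB0)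
    ((positiveTrace_rpow_add_le (by linarith) (by linarith) hA0 hB0).trans_lt
      (ENNReal.add_lt_top.mpr ⟨hA, hB⟩)) 2 fun x => ?_
  rw [add_apply (ContinuousLinearMap.adjoint A ∘L A), inner_add_right, Complex.add_re,
    re_inner_adjoint_comp_self, re_inner_adjoint_comp_self, add_apply]
  have h1 := norm_add_le (A x) (B x)
  have h2 := norm_nonneg (A x + B x)
  push_cast
  nlinarith [sq_nonneg (‖A x‖ - ‖B x‖)]

theorem IsSchatten.sub (hp : 0 < p) (hp2 : p ≤ 2) {A B : H →L[ℂ] K} (hA : IsSchatten p A)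
    (hB : IsSchatten p B) : IsSchatten p (A - B) := by
  rw [sub_eq_add_neg]
  exact hA.add hp hp2 (hB.neg hp hp2)

theorem IsSchatten.of_finiteDimensional_domain [FiniteDimensional ℂ H] (A : H →L[ℂ] K) :
    IsSchatten p A := by
  rw [IsSchatten, positiveTrace_eq (stdOrthonormalBasis ℂ H).toHilbertBasis CFC.rpow_nonneg,
    tsum_fintype]
  exact ENNReal.sum_lt_top.mpr fun _ _ => ENNReal.ofReal_lt_top

/-- A factors through its range, and the adjoint of that factor has finite-dimensional domain. -/
theorem IsSchatten.of_finiteDimensional_range (hp : 0 < p) (hp2 : p ≤ 2) (A : H →L[ℂ] K)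
    [FiniteDimensional ℂ A.range] : IsSchatten p A := by
  have hc : CompleteSpace A.range := FiniteDimensional.complete ℂ _
  let A' : H →L[ℂ] A.range := A.codRestrict A.range fun x => LinearMap.mem_range_self _ x
  have h := (IsSchatten.of_finiteDimensional_domain (p := p)
    (ContinuousLinearMap.adjoint A')).adjoint hp hp2
  rw [adjoint_adjoint] at h
  exact h.comp_left hp hp2 A.range.subtypeL

/-- L_p ⊆ L_2: on a bounded spectrum, t ≤ c^(1-p/2) t^(p/2). -/
theorem IsSchatten.positiveTrace_adjoint_comp_self_lt_top (hp : 0 < p) (hp2 : p ≤ 2)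
    {A : H →L[ℂ] K} (hA : IsSchatten p A) :
    positiveTrace (ContinuousLinearMap.adjoint A ∘L A) < ∞ := by
  have hX := adjoint_comp_self_nonneg A
  rw [IsSchatten] at hA
  set X := ContinuousLinearMap.adjoint A ∘L A
  -- The factor ‖1‖ lets this bound the spectrum even on the zero space.
  let c : ℝ := ‖X‖ * ‖(1 : H →L[ℂ] H)‖
  have hcont : Continuous fun t : ℝ => t ^ (p / 2) := Real.continuous_rpow_const (by linarith)
  have hle : X ≤ (c ^ (1 - p / 2)) • X ^ (p / 2) := by
    rw [CFC.rpow_eq_cfc_real hX, ← cfc_smul _ _ X hcont.continuousOn]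
    nth_rw 1 [← cfc_id' ℝ X]
    refine cfc_mono (fun t ht => ?_) continuousOn_id
      (hcont.const_smul (c ^ (1 - p / 2))).continuousOn
    have ht0 : 0 ≤ t := spectrum_nonneg_of_nonneg hX ht
    have htc : t ≤ c := (Real.le_norm_self t).trans (spectrum.norm_le_norm_mul_of_mem ht)
    rcases ht0.eq_or_lt with rfl | ht0
    · rw [Real.zero_rpow (by linarith), smul_zero]
    · calc t = t ^ (1 - p / 2) * t ^ (p / 2) := by
            rw [← Real.rpow_add ht0, sub_add_cancel, Real.rpow_one]
        _ ≤ _ := by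
            rw [smul_eq_mul]
            gcongr
            linarith
  refine (positiveTrace_mono hle).trans_lt ?_
  rw [positiveTrace_smul (by positivity)]
  exact ENNReal.mul_lt_top ENNReal.ofReal_lt_top hA

theorem exists_finiteDimensional_range_norm_sub_le {A : H →L[ℂ] K}
    (hA : positiveTrace (ContinuousLinearMap.adjoint A ∘L A) < ∞) {δ : ℝ} (hδ : 0 < δ) :
    ∃ F : K →L[ℂ] H, FiniteDimensional ℂ F.range ∧ ‖ContinuousLinearMap.adjoint A - F‖ ≤ δ := by
  obtain ⟨ι, b, -⟩ := exists_hilbertBasis ℂ H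
  rw [positiveTrace_adjoint_comp_self b] at hA
  obtain ⟨s, hs⟩ := ((ENNReal.tendsto_tsum_compl_atTop_zero hA.ne).eventually
    (gt_mem_nhds (show (0 : ℝ≥0∞) < ENNReal.ofReal (δ ^ 2) by positivity))).exists
  -- Projection onto finitely many basis vectors; the square of the norm error is at most the tail
  -- of ∑ ‖A b_i‖².
  let P : H →L[ℂ] H := ∑ i ∈ s, (innerSL ℂ (b i)).smulRight (b i)
  refine ⟨P ∘L ContinuousLinearMap.adjoint A, ?_, ?_⟩
  · have hle : (P ∘L ContinuousLinearMap.adjoint A).range ≤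
        Submodule.span ℂ ((fun i => b i) '' (s : Set ι)) := by
      rintro _ ⟨y, rfl⟩
      simp only [P, coe_coe, comp_apply, sum_apply, smulRight_apply]
      exact Submodule.sum_mem _ fun i hi => Submodule.smul_mem _ _
        (Submodule.subset_span ⟨i, hi, rfl⟩)
    have := FiniteDimensional.span_of_finite ℂ (s.finite_toSet.image (fun i => b i))
    exact Submodule.finiteDimensional_of_le hle
  · refine opNorm_le_bound _ hδ.le fun y => ?_
    refine le_of_sq_le_sq ?_ (by positivity)
    rw [← ENNReal.ofReal_le_ofReal_iff (by positivity), b.ofReal_norm_sq_eq_tsum]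
    classical
    have hcoord : ∀ j, inner ℂ (b j) ((ContinuousLinearMap.adjoint A -
        P ∘L ContinuousLinearMap.adjoint A) y) = if j ∈ s then 0 else inner ℂ (A (b j)) y := by
      intro j
      simp only [P, sub_apply, comp_apply, sum_apply, smulRight_apply, innerSL_apply_apply,
        inner_sub_right, inner_sum, inner_smul_right, orthonormal_iff_ite.mp b.orthonormal,
        adjoint_inner_right]
      by_cases hj : j ∈ s <;> simp [hj]
    rw [← tsum_subtype_eq_of_support_subset (s := {j | j ∉ s})]
    · calc _ ≤ ∑' j : {j // j ∉ s}, ENNReal.ofReal (‖A (b j)‖ ^ 2) * ENNReal.ofReal (‖y‖ ^ 2) := by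
            refine ENNReal.tsum_le_tsum fun j => ?_
            rw [← ENNReal.ofReal_mul (by positivity), hcoord, if_neg j.2, ← mul_pow]
            gcongr
            exact norm_inner_le_norm _ _
        _ ≤ ENNReal.ofReal (δ ^ 2) * ENNReal.ofReal (‖y‖ ^ 2) := by
            rw [ENNReal.tsum_mul_right]
            gcongr
        _ = _ := by rw [← ENNReal.ofReal_mul (by positivity), mul_pow]
    · intro j hj hjs
      exact hj (by beta_reduce; rw [hcoord, if_pos hjs]; simp)

end SchattenIdeal

/-! ### Fredholm operators and finite-rank perturbation -/

section Fredholm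

open ContinuousLinearMap LinearMap

variable {H : Type*} [NormedAddCommGroup H] [InnerProductSpace ℂ H] [CompleteSpace H]
variable {K : Type*} [NormedAddCommGroup K] [InnerProductSpace ℂ K] [CompleteSpace K]
variable {L : Type*} [NormedAddCommGroup L] [InnerProductSpace ℂ L] [CompleteSpace L]
variable {p : ℝ}

theorem LinearMap.HasFiniteRange.of_apply_eq {V W : Type*} [AddCommGroup V] [Module ℂ V]
    [AddCommGroup W] [Module ℂ W] {S T : V →ₗ[ℂ] W} (hT : T.HasFiniteRange)
    (h : ∀ x, S x = T x) : S.HasFiniteRange := by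
  rwa [LinearMap.ext h]

theorem ContinuousLinearMap.IsFredholm.of_left_right {H K : Type*} [NormedAddCommGroup H]
    [NormedSpace ℂ H] [NormedAddCommGroup K] [NormedSpace ℂ K] {f : H →L[ℂ] K} {l r : K →L[ℂ] H}
    (hl : ((.id ℂ H - l ∘L f : H →L[ℂ] H) : H →ₗ[ℂ] H).HasFiniteRange)
    (hr : ((.id ℂ K - f ∘L r : K →L[ℂ] K) : K →ₗ[ℂ] K).HasFiniteRange) : f.IsFredholm := by
  refine .of_isQuasiInverse (v := l) ⟨?_, ?_⟩
  · rw [IsLeftQuasiInverse, FiniteRangeSetoid.equiv_iff_hasFiniteRange]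
    exact hl.neg.of_apply_eq fun x => by simp
  · rw [IsRightQuasiInverse, FiniteRangeSetoid.equiv_iff_hasFiniteRange]
    -- The left quasi-inverse is also a right one: 1 - fl = (1 - fr) + f(1 - lf)r - fl(1 - fr).
    have h := ((hr.add ((hl.comp_right (r : K →ₗ[ℂ] H)).comp_left (f : H →ₗ[ℂ] K))).sub
      (hr.comp_left ((f : H →ₗ[ℂ] K) ∘ₗ (l : K →ₗ[ℂ] H)))).neg
    exact h.of_apply_eq fun x => by simp

/-- Take F of finite rank within 1/2 of X. Then 1 - (X - F) is invertible by Neumann series, and its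
inverse G satisfies 1 - G(1 - X) = GF and 1 - (1 - X)G = FG. -/
theorem exists_quasiInverse_id_sub {X : H →L[ℂ] H}
    (hX : ∀ δ : ℝ, 0 < δ → ∃ F : H →L[ℂ] H, FiniteDimensional ℂ F.range ∧ ‖X - F‖ ≤ δ) :
    ∃ G : H →L[ℂ] H,
      ((.id ℂ H - G ∘L (.id ℂ H - X) : H →L[ℂ] H) : H →ₗ[ℂ] H).HasFiniteRange ∧
      ((.id ℂ H - (.id ℂ H - X) ∘L G : H →L[ℂ] H) : H →ₗ[ℂ] H).HasFiniteRange := by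
  obtain ⟨F, hF, hle⟩ := hX (1 / 2) (by norm_num)
  have hFr : (F : H →ₗ[ℂ] H).HasFiniteRange := by
    rw [hasFiniteRange_iff_range, Submodule.fg_iff_finiteDimensional]
    exact hF
  let U : (H →L[ℂ] H)ˣ := Units.oneSub (X - F) (hle.trans_lt (by norm_num))
  let G : H →L[ℂ] H := (U⁻¹ : (H →L[ℂ] H)ˣ)
  have hU : ∀ x, U.1 x = x - X x + F x := fun x => by
    simp [U, sub_add]
  refine ⟨G, (hFr.comp_left (G : H →ₗ[ℂ] H)).of_apply_eq fun x => ?_,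
    (hFr.comp_right (G : H →ₗ[ℂ] H)).of_apply_eq fun x => ?_⟩
  · have h1 : G (x - X x + F x) = x := by
      rw [← hU]
      exact congr($(U.inv_mul) x)
    rw [map_add] at h1
    change x - G (x - X x) = G (F x)
    rw [sub_eq_iff_eq_add, add_comm, h1]
  · have h1 : G x - X (G x) + F (G x) = x := by
      rw [← hU]
      exact congr($(U.mul_inv) x)
    change x - (G x - X (G x)) = F (G x)
    rw [sub_eq_iff_eq_add, add_comm, h1]

theorem IsSchatten.exists_finiteDimensional_range_norm_sub_le (hp : 0 < p) (hp2 : p ≤ 2)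
    {A : H →L[ℂ] K} (hA : IsSchatten p A) (δ : ℝ) (hδ : 0 < δ) :
    ∃ F : H →L[ℂ] H, FiniteDimensional ℂ F.range ∧
      ‖ContinuousLinearMap.adjoint A ∘L A - F‖ ≤ δ := by
  obtain ⟨F, hF, hle⟩ := _root_.exists_finiteDimensional_range_norm_sub_le
    (hA.positiveTrace_adjoint_comp_self_lt_top hp hp2) (δ := δ / (‖A‖ + 1)) (by positivity)
  refine ⟨F ∘L A, Submodule.finiteDimensional_of_le (LinearMap.range_comp_le_range _ _), ?_⟩
  rw [← ContinuousLinearMap.sub_comp]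
  calc _ ≤ ‖ContinuousLinearMap.adjoint A - F‖ * ‖A‖ := opNorm_comp_le _ _
    _ ≤ δ / (‖A‖ + 1) * (‖A‖ + 1) := by gcongr; linarith
    _ = δ := by field_simp

/-- Both f'f and ff' have the form 1 - X with X approximable by finite rank; their quasi-inverses
give one-sided quasi-inverses of f. -/
theorem isFredholm_of_isSchatten (hp : 0 < p) (hp2 : p ≤ 2) {f : H →L[ℂ] K} {f' : K →L[ℂ] H}
    {g : H →L[ℂ] L} {M : Type*} [NormedAddCommGroup M] [InnerProductSpace ℂ M] [CompleteSpace M]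
    {h : K →L[ℂ] M} (hg : IsSchatten p g) (hh : IsSchatten p h)
    (hf : f' ∘L f + ContinuousLinearMap.adjoint g ∘L g = .id ℂ H)
    (hf' : f ∘L f' + ContinuousLinearMap.adjoint h ∘L h = .id ℂ K) : f.IsFredholm := by
  obtain ⟨G, hG, -⟩ := exists_quasiInverse_id_sub
    (hg.exists_finiteDimensional_range_norm_sub_le hp hp2)
  obtain ⟨G', -, hG'⟩ := exists_quasiInverse_id_sub
    (hh.exists_finiteDimensional_range_norm_sub_le hp hp2)
  rw [← hf, add_sub_cancel_right, hf, ← ContinuousLinearMap.comp_assoc] at hG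
  rw [← hf', add_sub_cancel_right, hf', ContinuousLinearMap.comp_assoc] at hG'
  exact .of_left_right hG hG'

theorem ContinuousLinearMap.IsFredholm.infinite_domain {H K : Type*} [NormedAddCommGroup H]
    [NormedSpace ℂ H] [NormedAddCommGroup K] [NormedSpace ℂ K] {f : H →L[ℂ] K} (hf : f.IsFredholm)
    (hK : ¬ FiniteDimensional ℂ K) : ¬ FiniteDimensional ℂ H := by
  intro hH
  have := hf.finite_coker
  rw [Submodule.CoFG] at this
  exact hK (Module.Finite.of_submodule_quotient f.range)

/-- If v is a quasi-inverse of f, then h = (hf)v - h(fv - 1), and the last term has finite rank. -/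
theorem ContinuousLinearMap.IsFredholm.isSchatten_of_comp (hp : 0 < p) (hp2 : p ≤ 2)
    {f : H →L[ℂ] K} (hf : f.IsFredholm) {h : K →L[ℂ] L} (hh : IsSchatten p (h ∘L f)) :
    IsSchatten p h := by
  obtain ⟨v, -, hv⟩ := hf.exists_isQuasiInverse
  rw [IsRightQuasiInverse, FiniteRangeSetoid.equiv_iff_hasFiniteRange] at hv
  have : FiniteDimensional ℂ (h ∘L (f ∘L v - .id ℂ K) : K →L[ℂ] L).range :=
    Submodule.fg_iff_finiteDimensional _ |>.mp (hv.comp_left (h : K →ₗ[ℂ] L))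
  convert (hh.comp_right hp hp2 v).sub hp hp2
    (IsSchatten.of_finiteDimensional_range hp hp2 (h ∘L (f ∘L v - .id ℂ K))) using 1
  ext x
  simp

end Fredholm

/-! ### Infinite-dimensional separable Hilbert spaces are isometric -/

section Isometry

variable {V W : Type*} [NormedAddCommGroup V] [InnerProductSpace ℂ V] [CompleteSpace V]
  [TopologicalSpace.SeparableSpace V] [NormedAddCommGroup W] [InnerProductSpace ℂ W]
  [CompleteSpace W] [TopologicalSpace.SeparableSpace W]

/-- Distinct orthonormal vectors are √2 apart, so balls of radius 1/2 around them are disjoint. -/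
theorem Orthonormal.countable_of_separable {E ι : Type*} [NormedAddCommGroup E]
    [InnerProductSpace ℂ E] [TopologicalSpace.SeparableSpace E] {v : ι → E}
    (hv : Orthonormal ℂ v) : Countable ι := by
  have hdist : Pairwise fun i j =>
      Disjoint (Metric.ball (v i) (1 / 2)) (Metric.ball (v j) (1 / 2)) := by
    intro i j hij
    refine Metric.ball_disjoint_ball ?_
    have h : ‖v i - v j‖ ^ 2 = 2 := by
      rw [@norm_sub_sq ℂ, hv.1 i, hv.1 j, hv.2 hij]
      norm_num
    rw [dist_eq_norm]
    nlinarith [norm_nonneg (v i - v j)]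
  exact hdist.countable_of_isOpen_disjoint (fun _ => Metric.isOpen_ball)
    fun i => ⟨v i, Metric.mem_ball_self (by norm_num)⟩

theorem exists_hilbertBasis_nat (hV : ¬ FiniteDimensional ℂ V) :
    Nonempty (HilbertBasis ℕ ℂ V) := by
  obtain ⟨ι, b, -⟩ := exists_hilbertBasis ℂ V
  have : Countable ι := b.orthonormal.countable_of_separable
  have : Infinite ι := by
    by_contra hfin
    rw [not_infinite_iff_finite] at hfin
    have := Fintype.ofFinite ι
    exact hV (b.toOrthonormalBasis.toBasis.finiteDimensional_of_finite)
  obtain ⟨e⟩ := nonempty_equiv_of_countable (α := ℕ) (β := ι)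
  refine ⟨HilbertBasis.mk (b.orthonormal.comp e e.injective) ?_⟩
  rw [e.surjective.range_comp, b.dense_span]

theorem nonempty_linearIsometryEquiv_of_infinite (hV : ¬ FiniteDimensional ℂ V)
    (hW : ¬ FiniteDimensional ℂ W) : Nonempty (V ≃ₗᵢ[ℂ] W) := by
  obtain ⟨b⟩ := exists_hilbertBasis_nat hV
  obtain ⟨c⟩ := exists_hilbertBasis_nat hW
  exact ⟨b.repr.trans c.repr.symm⟩

end Isometry

/-! ### Both conditions as differences of projections -/

section RestrictedProofs

open ContinuousLinearMap

variable {H : Type*} [NormedAddCommGroup H] [InnerProductSpace ℂ H] [CompleteSpace H]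
variable {p : ℝ}

/-- The orthogonal projection of `H` onto the closed subspace `V`. -/
noncomputable abbrev ClosedSubmodule.proj (V : ClosedSubmodule ℂ H) : H →L[ℂ] H :=
  V.toSubmodule.starProjection

theorem ClosedSubmodule.proj_orthogonal (V : ClosedSubmodule ℂ H) :
    V.orthogonal.proj = 1 - V.proj :=
  V.toSubmodule.starProjection_orthogonal'

theorem ClosedSubmodule.proj_mul_self (V : ClosedSubmodule ℂ H) : V.proj * V.proj = V.proj :=
  V.toSubmodule.isIdempotentElem_starProjection

theorem adjoint_projRestrict (V W : ClosedSubmodule ℂ H) :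
    adjoint (projRestrict V W) = projRestrict W V := by
  rw [projRestrict, adjoint_comp, Submodule.adjoint_subtypeL,
    Submodule.adjoint_orthogonalProjectionOnto]
  rfl

theorem projRestrict_self (V : ClosedSubmodule ℂ H) : projRestrict V V = .id ℂ V.toSubmodule := by
  ext x
  simp [projRestrict]

theorem projRestrict_orthogonal (V : ClosedSubmodule ℂ H) : projRestrict V V.orthogonal = 0 := by
  ext x
  simp only [projRestrict, comp_apply, Submodule.subtypeL_apply, zero_apply]
  exact congrArg Subtype.val
    (Submodule.orthogonalProjectionOnto_orthogonal_apply_eq_zero (K := V.toSubmodule) x.2)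

theorem projRestrict_eq_add (V W U : ClosedSubmodule ℂ H) :
    projRestrict W U ∘L projRestrict V W +
      projRestrict W.orthogonal U ∘L projRestrict V W.orthogonal = projRestrict V U := by
  ext x
  have h : W.proj x + W.orthogonal.proj x = (x : H) := by
    rw [W.proj_orthogonal]; simp
  simp only [projRestrict, comp_apply, Submodule.subtypeL_apply, add_apply]
  rw [← map_add]
  exact congrArg (fun y => (U.toSubmodule.orthogonalProjectionOnto y : H)) h

theorem isSchatten_projRestrict_iff (hp : 0 < p) (hp2 : p ≤ 2) (V W : ClosedSubmodule ℂ H) :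
    IsSchatten p (projRestrict V W) ↔ IsSchatten p (W.proj * V.proj) := by
  constructor
  · intro h
    exact (h.comp_right hp hp2 V.toSubmodule.orthogonalProjectionOnto).comp_left hp hp2
      W.toSubmodule.subtypeL
  · intro h
    convert (h.comp_right hp hp2 V.toSubmodule.subtypeL).comp_left hp hp2
      W.toSubmodule.orthogonalProjectionOnto using 1
    ext x
    simpa [projRestrict] using congr($(W.proj_mul_self.symm) (x : H))

/-- Let f, g be the components of V in W and Wᗮ. Forward: the zero map V → Vᗮ, split through W and
Wᗮ, shows that (W → Vᗮ) ∘ f is in L_p, and f cancels. Backward: splitting the identities of V and W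
gives f*f + g*g = 1 and its counterpart on W. -/
theorem isFredholm_projRestrict_iff (hp : 0 < p) (hp2 : p ≤ 2) {V W : ClosedSubmodule ℂ H}
    (hVW : IsSchatten p (projRestrict V W.orthogonal)) :
    (projRestrict V W).IsFredholm ↔ IsSchatten p (projRestrict W V.orthogonal) := by
  constructor
  · intro hf
    refine hf.isSchatten_of_comp hp hp2 ?_
    have h := projRestrict_eq_add V W V.orthogonal
    rw [projRestrict_orthogonal, ← eq_neg_iff_add_eq_zero] at h
    rw [h]
    exact (hVW.comp_left hp hp2 _).neg hp hp2
  · intro hWV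
    refine isFredholm_of_isSchatten hp hp2 (f' := projRestrict W V) hVW hWV ?_ ?_
    · rw [adjoint_projRestrict, projRestrict_eq_add, projRestrict_self]
    · rw [adjoint_projRestrict, projRestrict_eq_add, projRestrict_self]

/-- P_V - P = (1 - P)P_V - P(1 - P_V), where the two terms are the L_p and Fredholm conditions, the
second up to an adjoint. Multiplying by 1 - P or 1 - P_V on the left recovers each. -/
theorem mem_restrictedGrassmannian_iff (hp : 0 < p) (hp2 : p ≤ 2) {Hp V : ClosedSubmodule ℂ H} :
    V ∈ restrictedGrassmannian p Hp ↔ IsSchatten p (V.proj - Hp.proj) := by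
  have hV := V.proj_mul_self
  have hHp := Hp.proj_mul_self
  have key : V ∈ restrictedGrassmannian p Hp ↔
      IsSchatten p (Hp.orthogonal.proj * V.proj) ∧ IsSchatten p (V.orthogonal.proj * Hp.proj) := by
    rw [← isSchatten_projRestrict_iff hp hp2, ← isSchatten_projRestrict_iff hp hp2, and_comm]
    exact and_comm.trans (and_congr_right fun h => isFredholm_projRestrict_iff hp hp2 h) |>.trans
      and_comm
  rw [key, Hp.proj_orthogonal, V.proj_orthogonal]
  constructor
  · rintro ⟨h1, h2⟩
    have h3 := h2.adjoint hp hp2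
    have h4 : adjoint ((1 - V.proj) * Hp.proj) = Hp.proj * (1 - V.proj) := by
      rw [← star_eq_adjoint, star_mul, star_sub, star_one,
        isSelfAdjoint_starProjection Hp.toSubmodule, isSelfAdjoint_starProjection V.toSubmodule]
    rw [h4] at h3
    convert h1.sub hp hp2 h3 using 1
    noncomm_ring
  · intro h
    constructor
    · convert h.comp_left hp hp2 (1 - Hp.proj) using 1
      rw [← mul_def, mul_sub, sub_mul _ _ Hp.proj, hHp, one_mul, sub_self, sub_zero]
    · convert (h.comp_left hp hp2 (1 - V.proj)).neg hp hp2 using 1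
      rw [← mul_def, mul_sub, sub_mul _ _ V.proj, hV, one_mul, sub_self, zero_sub, neg_neg]

theorem polarizationOp_eq (Hp : ClosedSubmodule ℂ H) :
    polarizationOp Hp = Complex.I • ((2 : ℂ) • Hp.proj - 1) := by
  rw [polarizationOp, two_smul]
  congr 1
  change Hp.proj - Hp.orthogonal.proj = _
  rw [Hp.proj_orthogonal]
  abel

theorem polarizationOp_commutator (Hp : ClosedSubmodule ℂ H) (U : H →L[ℂ] H) :
    polarizationOp Hp * U - U * polarizationOp Hp =
      (2 * Complex.I) • (Hp.proj * U - U * Hp.proj) := by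
  rw [polarizationOp_eq, smul_mul_assoc, mul_smul_comm, ← smul_sub, sub_mul, mul_sub,
    smul_mul_assoc, mul_smul_comm, one_mul, mul_one, sub_sub_sub_cancel_right, ← smul_sub,
    smul_smul, mul_comm]

/-- [d, u] = 2i(Pu - uP) = -2i(uPu* - P)u. -/
theorem mem_restrictedUnitary_iff (hp : 0 < p) (hp2 : p ≤ 2) {Hp : ClosedSubmodule ℂ H}
    {u : unitary (H →L[ℂ] H)} : u ∈ restrictedUnitary p Hp ↔
      IsSchatten p ((u : H →L[ℂ] H) * Hp.proj * star (u : H →L[ℂ] H) - Hp.proj) := by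
  have h1 : (u : H →L[ℂ] H) * star (u : H →L[ℂ] H) = 1 := Unitary.coe_mul_star_self u
  have h2 : star (u : H →L[ℂ] H) * (u : H →L[ℂ] H) = 1 := Unitary.coe_star_mul_self u
  have hmem : u ∈ restrictedUnitary p Hp ↔ IsSchatten p (polarizationOp Hp * (u : H →L[ℂ] H) -
    (u : H →L[ℂ] H) * polarizationOp Hp) := Iff.rfl
  rw [hmem, polarizationOp_commutator]
  generalize (u : H →L[ℂ] H) = U at h1 h2
  have hI : (2 * Complex.I)⁻¹ * (2 * Complex.I) = 1 := inv_mul_cancel₀ (by simp)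
  constructor
  · intro h
    have h3 := ((h.smul hp hp2 (2 * Complex.I)⁻¹).neg hp hp2).comp_right hp hp2 (star U)
    rw [smul_smul, hI, one_smul, neg_sub, ← mul_def, sub_mul, mul_assoc Hp.proj, h1, mul_one] at h3
    exact h3
  · intro h
    have h3 := ((h.comp_right hp hp2 U).neg hp hp2)
    rw [← mul_def, sub_mul, mul_assoc _ (star U), h2, mul_one, neg_sub] at h3
    exact h3.smul hp hp2 _

end RestrictedProofs

/-! ### The restricted group and its action -/

section UnitaryAction

open ContinuousLinearMap

variable {H : Type*} [NormedAddCommGroup H] [InnerProductSpace ℂ H] [CompleteSpace H]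
variable {p : ℝ}

/-- The image of a closed subspace under a unitary operator. -/
noncomputable def ClosedSubmodule.unitaryImage (u : unitary (H →L[ℂ] H))
    (V : ClosedSubmodule ℂ H) : ClosedSubmodule ℂ H :=
  V.comap ((star u : unitary (H →L[ℂ] H)) : H →L[ℂ] H)

theorem unitary_star_apply_apply (u : unitary (H →L[ℂ] H)) (x : H) :
    (star (u : H →L[ℂ] H)) ((u : H →L[ℂ] H) x) = x :=
  congr($(Unitary.coe_star_mul_self u) x)

theorem unitary_apply_star_apply (u : unitary (H →L[ℂ] H)) (x : H) :
    (u : H →L[ℂ] H) ((star (u : H →L[ℂ] H)) x) = x :=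
  congr($(Unitary.coe_mul_star_self u) x)

theorem ClosedSubmodule.mem_unitaryImage {u : unitary (H →L[ℂ] H)} {V : ClosedSubmodule ℂ H}
    {x : H} : x ∈ V.unitaryImage u ↔ (star (u : H →L[ℂ] H)) x ∈ V := Iff.rfl

theorem ClosedSubmodule.coe_unitaryImage (u : unitary (H →L[ℂ] H)) (V : ClosedSubmodule ℂ H) :
    (V.unitaryImage u : Set H) = (u : H →L[ℂ] H) '' (V : Set H) := by
  ext x
  constructor
  · exact fun hx => ⟨_, hx, unitary_apply_star_apply u x⟩
  · rintro ⟨y, hy, rfl⟩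
    rw [SetLike.mem_coe, mem_unitaryImage, unitary_star_apply_apply]
    exact hy

theorem ClosedSubmodule.unitaryImage_one (V : ClosedSubmodule ℂ H) : V.unitaryImage 1 = V := by
  apply SetLike.coe_injective
  rw [coe_unitaryImage]
  simp

theorem ClosedSubmodule.unitaryImage_mul (u v : unitary (H →L[ℂ] H)) (V : ClosedSubmodule ℂ H) :
    V.unitaryImage (u * v) = (V.unitaryImage v).unitaryImage u := by
  apply SetLike.coe_injective
  rw [coe_unitaryImage, coe_unitaryImage, coe_unitaryImage, Set.image_image]
  rfl

theorem ClosedSubmodule.proj_unitaryImage (u : unitary (H →L[ℂ] H)) (V : ClosedSubmodule ℂ H) :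
    (V.unitaryImage u).proj = (u : H →L[ℂ] H) * V.proj * star (u : H →L[ℂ] H) := by
  ext x
  refine Submodule.eq_starProjection_of_mem_of_inner_eq_zero
    (K := (V.unitaryImage u).toSubmodule) ?_ fun w hw => ?_
  · change (star (u : H →L[ℂ] H)) ((u : H →L[ℂ] H) _) ∈ V
    rw [unitary_star_apply_apply]
    exact V.toSubmodule.starProjection_apply_mem _
  · obtain ⟨w, hwV, rfl⟩ : w ∈ (u : H →L[ℂ] H) '' (V : Set H) := by
      rw [← V.coe_unitaryImage]; exact hw
    have h := V.toSubmodule.starProjection_inner_eq_zero ((star (u : H →L[ℂ] H)) x) w hwV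
    rw [← adjoint_inner_left, map_sub]
    change inner ℂ ((star (u : H →L[ℂ] H)) x - (star (u : H →L[ℂ] H)) ((u : H →L[ℂ] H) _)) w = 0
    rw [unitary_star_apply_apply]
    exact h

/-- u P_V u* - P = u(P_V - P)u* + (uPu* - P). The same identity, solved for the last term, gives
`mem_restrictedUnitary_of_unitaryImage`. -/
theorem unitaryImage_mem_restrictedGrassmannian (hp : 0 < p) (hp2 : p ≤ 2)
    {Hp V : ClosedSubmodule ℂ H} {u : unitary (H →L[ℂ] H)} (hu : u ∈ restrictedUnitary p Hp)
    (hV : V ∈ restrictedGrassmannian p Hp) : V.unitaryImage u ∈ restrictedGrassmannian p Hp := by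
  rw [mem_restrictedGrassmannian_iff hp hp2] at hV ⊢
  rw [mem_restrictedUnitary_iff hp hp2] at hu
  rw [V.proj_unitaryImage]
  convert ((hV.comp_right hp hp2 (star (u : H →L[ℂ] H))).comp_left hp hp2
    (u : H →L[ℂ] H)).add hp hp2 hu using 1
  rw [← mul_def, ← mul_def]
  noncomm_ring

theorem mem_restrictedUnitary_of_unitaryImage (hp : 0 < p) (hp2 : p ≤ 2)
    {Hp V : ClosedSubmodule ℂ H} {u : unitary (H →L[ℂ] H)} (hV : V ∈ restrictedGrassmannian p Hp)
    (huV : V.unitaryImage u ∈ restrictedGrassmannian p Hp) : u ∈ restrictedUnitary p Hp := by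
  rw [mem_restrictedGrassmannian_iff hp hp2] at hV huV
  rw [mem_restrictedUnitary_iff hp hp2]
  rw [V.proj_unitaryImage] at huV
  convert huV.sub hp hp2 ((hV.comp_right hp hp2 (star (u : H →L[ℂ] H))).comp_left hp hp2
    (u : H →L[ℂ] H)) using 1
  rw [← mul_def, ← mul_def]
  noncomm_ring

theorem self_mem_restrictedGrassmannian (hp : 0 < p) (hp2 : p ≤ 2) (Hp : ClosedSubmodule ℂ H) :
    Hp ∈ restrictedGrassmannian p Hp := by
  rw [mem_restrictedGrassmannian_iff hp hp2, sub_self]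
  exact .zero hp.ne'

/-- Complementation only changes the sign of P_V - P. This yields that Vᗮ, too, is
infinite-dimensional. -/
theorem orthogonal_mem_restrictedGrassmannian (hp : 0 < p) (hp2 : p ≤ 2)
    {Hp V : ClosedSubmodule ℂ H} (hV : V ∈ restrictedGrassmannian p Hp) :
    V.orthogonal ∈ restrictedGrassmannian p Hp.orthogonal := by
  rw [mem_restrictedGrassmannian_iff hp hp2] at hV ⊢
  rw [V.proj_orthogonal, Hp.proj_orthogonal, sub_sub_sub_cancel_left, ← neg_sub]
  exact hV.neg hp hp2

theorem infinite_of_mem_restrictedGrassmannian {Hp V : ClosedSubmodule ℂ H}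
    (hHp : ¬ FiniteDimensional ℂ Hp.toSubmodule) (hV : V ∈ restrictedGrassmannian p Hp) :
    ¬ FiniteDimensional ℂ V.toSubmodule :=
  hV.1.infinite_domain hHp

/-- The group `U_{res,p}(H)`. -/
def restrictedUnitarySubgroup (hp : 0 < p) (hp2 : p ≤ 2) (Hp : ClosedSubmodule ℂ H) :
    Subgroup (unitary (H →L[ℂ] H)) where
  carrier := restrictedUnitary p Hp
  mul_mem' {a b} ha hb := by
    have hHp := self_mem_restrictedGrassmannian hp hp2 Hp
    -- Membership is tested on the image of H₊ alone.
    refine mem_restrictedUnitary_of_unitaryImage hp hp2 hHp ?_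
    rw [Hp.unitaryImage_mul]
    exact unitaryImage_mem_restrictedGrassmannian hp hp2 ha
      (unitaryImage_mem_restrictedGrassmannian hp hp2 hb hHp)
  one_mem' := by
    have hHp := self_mem_restrictedGrassmannian hp hp2 Hp
    refine mem_restrictedUnitary_of_unitaryImage hp hp2 hHp ?_
    rwa [Hp.unitaryImage_one]
  inv_mem' {a} ha := by
    have hHp := self_mem_restrictedGrassmannian hp hp2 Hp
    refine mem_restrictedUnitary_of_unitaryImage hp hp2
      (unitaryImage_mem_restrictedGrassmannian hp hp2 ha hHp) ?_
    rwa [← Hp.unitaryImage_mul, inv_mul_cancel, Hp.unitaryImage_one]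

/-- The action `(u, V) ↦ u(V)` of `U_{res,p}(H)` on `Gr_{res,p}(H)`. -/
noncomputable abbrev restrictedAction (hp : 0 < p) (hp2 : p ≤ 2) (Hp : ClosedSubmodule ℂ H) :
    MulAction (restrictedUnitarySubgroup hp hp2 Hp) (restrictedGrassmannian p Hp) where
  smul g V := ⟨V.1.unitaryImage g.1, unitaryImage_mem_restrictedGrassmannian hp hp2 g.2 V.2⟩
  one_smul V := Subtype.ext V.1.unitaryImage_one
  mul_smul g h V := Subtype.ext (V.1.unitaryImage_mul g.1 h.1)

end UnitaryAction

/-! ### Block-diagonal unitaries and the stabilizer -/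

section BlockDiagonal

open ContinuousLinearMap

variable {H : Type*} [NormedAddCommGroup H] [InnerProductSpace ℂ H] [CompleteSpace H]
variable {p : ℝ}

/-- The operator `A ⊕ B` on `H = V ⊕ Vᗮ = W ⊕ Wᗮ`. -/
noncomputable def blockMap (V W : ClosedSubmodule ℂ H) (A : V.toSubmodule →L[ℂ] W.toSubmodule)
    (B : V.orthogonal.toSubmodule →L[ℂ] W.orthogonal.toSubmodule) : H →L[ℂ] H :=
  W.toSubmodule.subtypeL ∘L A ∘L V.toSubmodule.orthogonalProjectionOnto +
    W.orthogonal.toSubmodule.subtypeL ∘L B ∘L V.orthogonal.toSubmodule.orthogonalProjectionOnto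

variable {U V W : ClosedSubmodule ℂ H}

theorem ClosedSubmodule.exists_add_eq (V : ClosedSubmodule ℂ H) (x : H) :
    ∃ (y : V.toSubmodule) (z : V.orthogonal.toSubmodule), (y : H) + z = x := by
  refine ⟨V.toSubmodule.orthogonalProjectionOnto x,
    V.orthogonal.toSubmodule.orthogonalProjectionOnto x, ?_⟩
  change V.proj x + V.orthogonal.proj x = x
  rw [V.proj_orthogonal]
  simp

theorem ClosedSubmodule.ext_of_eqOn {S T : H →L[ℂ] H} (V : ClosedSubmodule ℂ H)
    (h1 : ∀ y : V.toSubmodule, S y = T y) (h2 : ∀ z : V.orthogonal.toSubmodule, S z = T z) :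
    S = T := by
  ext x
  obtain ⟨y, z, rfl⟩ := V.exists_add_eq x
  rw [map_add, map_add, h1, h2]

theorem blockMap_apply_left (A : V.toSubmodule →L[ℂ] W.toSubmodule)
    (B : V.orthogonal.toSubmodule →L[ℂ] W.orthogonal.toSubmodule) (x : V.toSubmodule) :
    blockMap V W A B x = A x := by
  have h1 : V.toSubmodule.orthogonalProjectionOnto (x : H) = x := by simp
  have h2 : V.orthogonal.toSubmodule.orthogonalProjectionOnto (x : H) = 0 :=
    congr($(projRestrict_orthogonal V) x)
  simp only [blockMap, add_apply, comp_apply, h1, h2, map_zero, add_zero, Submodule.subtypeL_apply]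

theorem blockMap_apply_right (A : V.toSubmodule →L[ℂ] W.toSubmodule)
    (B : V.orthogonal.toSubmodule →L[ℂ] W.orthogonal.toSubmodule)
    (x : V.orthogonal.toSubmodule) : blockMap V W A B x = B x := by
  have h1 : V.orthogonal.toSubmodule.orthogonalProjectionOnto (x : H) = x :=
    congr($(projRestrict_self V.orthogonal) x)
  have h2 : V.toSubmodule.orthogonalProjectionOnto (x : H) = 0 :=
    Submodule.orthogonalProjectionOnto_eq_zero_iff.mpr x.2
  simp only [blockMap, add_apply, comp_apply, h1, h2, map_zero, zero_add, Submodule.subtypeL_apply]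

theorem blockMap_mul (A : U.toSubmodule →L[ℂ] V.toSubmodule)
    (B : U.orthogonal.toSubmodule →L[ℂ] V.orthogonal.toSubmodule)
    (A' : V.toSubmodule →L[ℂ] W.toSubmodule)
    (B' : V.orthogonal.toSubmodule →L[ℂ] W.orthogonal.toSubmodule) :
    blockMap V W A' B' * blockMap U V A B = blockMap U W (A' ∘L A) (B' ∘L B) := by
  refine U.ext_of_eqOn (fun y => ?_) fun z => ?_
  · change blockMap V W A' B' (blockMap U V A B y) = _
    rw [blockMap_apply_left, blockMap_apply_left, blockMap_apply_left, comp_apply]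
  · change blockMap V W A' B' (blockMap U V A B z) = _
    rw [blockMap_apply_right, blockMap_apply_right, blockMap_apply_right, comp_apply]

theorem blockMap_id : blockMap V V (.id ℂ _) (.id ℂ _) = 1 :=
  V.ext_of_eqOn (fun y => by rw [blockMap_apply_left]; rfl)
    fun z => by rw [blockMap_apply_right]; rfl

theorem adjoint_blockMap (A : V.toSubmodule →L[ℂ] W.toSubmodule)
    (B : V.orthogonal.toSubmodule →L[ℂ] W.orthogonal.toSubmodule) :
    adjoint (blockMap V W A B) = blockMap W V (adjoint A) (adjoint B) := by
  simp only [blockMap, map_add, adjoint_comp, Submodule.adjoint_subtypeL,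
    Submodule.adjoint_orthogonalProjectionOnto]
  rfl

theorem blockMap_mem_unitary {A : V.toSubmodule →L[ℂ] W.toSubmodule}
    {B : V.orthogonal.toSubmodule →L[ℂ] W.orthogonal.toSubmodule}
    (hA : adjoint A ∘L A = .id ℂ _) (hA' : A ∘L adjoint A = .id ℂ _)
    (hB : adjoint B ∘L B = .id ℂ _) (hB' : B ∘L adjoint B = .id ℂ _) :
    blockMap V W A B ∈ unitary (H →L[ℂ] H) := by
  rw [Unitary.mem_iff, star_eq_adjoint, adjoint_blockMap, blockMap_mul, blockMap_mul, hA, hA', hB,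
    hB', blockMap_id, blockMap_id]
  exact ⟨rfl, rfl⟩

theorem unitaryImage_eq_of_blockMap {u : unitary (H →L[ℂ] H)}
    {A : V.toSubmodule →L[ℂ] W.toSubmodule}
    {B : V.orthogonal.toSubmodule →L[ℂ] W.orthogonal.toSubmodule}
    (hA' : A ∘L adjoint A = .id ℂ _) (hu : (u : H →L[ℂ] H) = blockMap V W A B) :
    V.unitaryImage u = W := by
  apply SetLike.coe_injective
  rw [V.coe_unitaryImage, hu]
  ext x
  constructor
  · rintro ⟨y, hy, rfl⟩
    rw [blockMap_apply_left A B ⟨y, hy⟩]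
    exact (A _).2
  · intro hx
    refine ⟨(adjoint A ⟨x, hx⟩ : V.toSubmodule), (adjoint A ⟨x, hx⟩).2, ?_⟩
    rw [blockMap_apply_left]
    exact congrArg Subtype.val congr($hA' ⟨x, hx⟩)

theorem adjoint_comp_self_linearIsometryEquiv {E F : Type*} [NormedAddCommGroup E]
    [InnerProductSpace ℂ E] [CompleteSpace E] [NormedAddCommGroup F] [InnerProductSpace ℂ F]
    [CompleteSpace F] (e : E ≃ₗᵢ[ℂ] F) :
    adjoint (e : E →L[ℂ] F) ∘L (e : E →L[ℂ] F) = .id ℂ E ∧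
      (e : E →L[ℂ] F) ∘L adjoint (e : E →L[ℂ] F) = .id ℂ F := by
  rw [LinearIsometryEquiv.adjoint_eq_symm]
  constructor <;> ext x <;> simp

theorem exists_unitaryImage_eq (hV : Nonempty (V.toSubmodule ≃ₗᵢ[ℂ] W.toSubmodule))
    (hV' : Nonempty (V.orthogonal.toSubmodule ≃ₗᵢ[ℂ] W.orthogonal.toSubmodule)) :
    ∃ u : unitary (H →L[ℂ] H), V.unitaryImage u = W := by
  obtain ⟨e⟩ := hV
  obtain ⟨f⟩ := hV'
  obtain ⟨h1, h2⟩ := adjoint_comp_self_linearIsometryEquiv e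
  obtain ⟨h3, h4⟩ := adjoint_comp_self_linearIsometryEquiv f
  exact ⟨⟨_, blockMap_mem_unitary h1 h2 h3 h4⟩, unitaryImage_eq_of_blockMap h2 rfl⟩

/-- The block diagonal unitaries, as a homomorphism `U(V) × U(Vᗮ) → U(H)`. -/
noncomputable def blockHom (V : ClosedSubmodule ℂ H) :
    unitary (V.toSubmodule →L[ℂ] V.toSubmodule) ×
      unitary (V.orthogonal.toSubmodule →L[ℂ] V.orthogonal.toSubmodule) →*
      unitary (H →L[ℂ] H) where
  toFun a := ⟨blockMap V V a.1 a.2, blockMap_mem_unitary (Unitary.coe_star_mul_self a.1)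
    (Unitary.coe_mul_star_self a.1) (Unitary.coe_star_mul_self a.2)
    (Unitary.coe_mul_star_self a.2)⟩
  map_one' := Subtype.ext blockMap_id
  map_mul' _ _ := Subtype.ext (blockMap_mul _ _ _ _).symm

theorem coe_blockHom (a : unitary (V.toSubmodule →L[ℂ] V.toSubmodule) ×
    unitary (V.orthogonal.toSubmodule →L[ℂ] V.orthogonal.toSubmodule)) :
    (blockHom V a : H →L[ℂ] H) = blockMap V V a.1 a.2 := rfl

theorem blockHom_injective (V : ClosedSubmodule ℂ H) : Function.Injective (blockHom V) := by
  intro a b h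
  have h' : blockMap V V (a.1 : V.toSubmodule →L[ℂ] V.toSubmodule) a.2 = blockMap V V b.1 b.2 :=
    congrArg Subtype.val h
  refine Prod.ext (Subtype.ext ?_) (Subtype.ext ?_)
  · ext x
    rw [← blockMap_apply_left _ a.2.1, ← blockMap_apply_left _ b.2.1, h']
  · ext x
    rw [← blockMap_apply_right a.1.1, ← blockMap_apply_right b.1.1, h']

theorem unitaryImage_blockHom (a : unitary (V.toSubmodule →L[ℂ] V.toSubmodule) ×
    unitary (V.orthogonal.toSubmodule →L[ℂ] V.orthogonal.toSubmodule)) :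
    V.unitaryImage (blockHom V a) = V :=
  unitaryImage_eq_of_blockMap (Unitary.coe_mul_star_self a.1) (coe_blockHom a)

/-- Here P_V = u P_V u*; multiply by u on the right. -/
theorem commute_proj_of_unitaryImage_eq {u : unitary (H →L[ℂ] H)} (hu : V.unitaryImage u = V) :
    Commute (u : H →L[ℂ] H) V.proj := by
  have h := V.proj_unitaryImage u
  rw [hu] at h
  have h2 : star (u : H →L[ℂ] H) * (u : H →L[ℂ] H) = 1 := Unitary.coe_star_mul_self u
  rw [Commute, SemiconjBy]
  nth_rw 2 [h]
  rw [mul_assoc _ (star (u : H →L[ℂ] H)), h2, mul_one]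

/-- The compression of an operator to the closed subspace `V`. -/
noncomputable def compression (V : ClosedSubmodule ℂ H) (T : H →L[ℂ] H) :
    V.toSubmodule →L[ℂ] V.toSubmodule :=
  V.toSubmodule.orthogonalProjectionOnto ∘L T ∘L V.toSubmodule.subtypeL

theorem coe_compression_apply {T : H →L[ℂ] H} (h : Commute T V.proj) (x : V.toSubmodule) :
    (compression V T x : H) = T x := by
  have h1 : V.proj (T x) = T (V.proj x) := congr($(h.eq.symm) (x : H))
  have h2 : V.proj x = x := by simp
  rw [h2] at h1
  exact h1

theorem adjoint_compression (T : H →L[ℂ] H) :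
    adjoint (compression V T) = compression V (adjoint T) := by
  simp only [compression, adjoint_comp, Submodule.adjoint_subtypeL,
    Submodule.adjoint_orthogonalProjectionOnto]
  rfl

theorem compression_mem_unitary {u : unitary (H →L[ℂ] H)}
    (h : Commute (u : H →L[ℂ] H) V.proj) :
    compression V (u : H →L[ℂ] H) ∈ unitary (V.toSubmodule →L[ℂ] V.toSubmodule) := by
  have h' : Commute (star (u : H →L[ℂ] H)) V.proj := by
    have := h.star_star
    rwa [(isSelfAdjoint_starProjection V.toSubmodule).star_eq] at this
  rw [Unitary.mem_iff, star_eq_adjoint, adjoint_compression]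
  constructor
  · ext x
    change (compression V (star (u : H →L[ℂ] H)) (compression V (u : H →L[ℂ] H) x) : H) = x
    rw [coe_compression_apply h', coe_compression_apply h, unitary_star_apply_apply]
  · ext x
    change (compression V (u : H →L[ℂ] H) (compression V (star (u : H →L[ℂ] H)) x) : H) = x
    rw [coe_compression_apply h, coe_compression_apply h', unitary_apply_star_apply]

theorem exists_blockHom_eq {u : unitary (H →L[ℂ] H)} (hu : V.unitaryImage u = V) :
    ∃ a, blockHom V a = u := by
  have h := commute_proj_of_unitaryImage_eq hu
  have h' : Commute (u : H →L[ℂ] H) V.orthogonal.proj := by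
    rw [V.proj_orthogonal]
    exact (Commute.one_right _).sub_right h
  refine ⟨(⟨_, compression_mem_unitary h⟩, ⟨_, compression_mem_unitary h'⟩), Subtype.ext ?_⟩
  rw [coe_blockHom]
  refine V.ext_of_eqOn (fun y => ?_) fun z => ?_
  · rw [blockMap_apply_left, coe_compression_apply h]
  · rw [blockMap_apply_right, coe_compression_apply h']

/-- The isomorphism of `U(Hp) × U(Hpᗮ)` onto the stabilizer of `Hp`. -/
noncomputable def stabilizerEquiv (hp : 0 < p) (hp2 : p ≤ 2) (Hp : ClosedSubmodule ℂ H) :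
    letI := restrictedAction hp hp2 Hp
    unitary (Hp.toSubmodule →L[ℂ] Hp.toSubmodule) ×
      unitary (Hp.orthogonal.toSubmodule →L[ℂ] Hp.orthogonal.toSubmodule) ≃*
    MulAction.stabilizer (restrictedUnitarySubgroup hp hp2 Hp)
      (⟨Hp, self_mem_restrictedGrassmannian hp hp2 Hp⟩ : restrictedGrassmannian p Hp) :=
  letI := restrictedAction hp hp2 Hp
  have hmem : ∀ a, blockHom Hp a ∈ restrictedUnitarySubgroup hp hp2 Hp := fun a =>
    mem_restrictedUnitary_of_unitaryImage hp hp2 (self_mem_restrictedGrassmannian hp hp2 Hp)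
      (by rw [unitaryImage_blockHom]; exact self_mem_restrictedGrassmannian hp hp2 Hp)
  MulEquiv.ofBijective
    (((blockHom Hp).codRestrict (restrictedUnitarySubgroup hp hp2 Hp) hmem).codRestrict
      (MulAction.stabilizer (restrictedUnitarySubgroup hp hp2 Hp)
        (⟨Hp, self_mem_restrictedGrassmannian hp hp2 Hp⟩ : restrictedGrassmannian p Hp))
      fun a => Subtype.ext (unitaryImage_blockHom a))
    ⟨fun a b h => blockHom_injective Hp (congrArg (fun g => (g.1.1 : unitary (H →L[ℂ] H))) h),
      fun g => by
        obtain ⟨a, ha⟩ := exists_blockHom_eq (V := Hp) (u := g.1.1) (congrArg Subtype.val g.2)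
        exact ⟨a, Subtype.ext (Subtype.ext ha)⟩⟩

end BlockDiagonal

/-! ### The proposition -/

theorem mainTheorem5 {H : Type*} [NormedAddCommGroup H] [InnerProductSpace ℂ H] [CompleteSpace H]
    [TopologicalSpace.SeparableSpace H]
    (Hp : ClosedSubmodule ℂ H)
    (hplus : ¬ FiniteDimensional ℂ Hp.toSubmodule)
    (hminus : ¬ FiniteDimensional ℂ Hp.orthogonal.toSubmodule)
    (p : ℝ) (hp1 : 1 < p) (hp2 : p ≤ 2) :
    -- `U_{res,p}(H)` is a subgroup of `U(H)`
    ∃ G : Subgroup (unitary (H →L[ℂ] H)), (G : Set (unitary (H →L[ℂ] H))) = restrictedUnitary p Hp ∧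
    -- which acts on the Grassmannian by taking images of subspaces
    ∃ act : MulAction G (restrictedGrassmannian p Hp),
      (∀ (g : G) (V : restrictedGrassmannian p Hp),
        ((g • V : restrictedGrassmannian p Hp).1 : Set H) =
          ((g : unitary (H →L[ℂ] H)) : H →L[ℂ] H) '' (V.1 : Set H)) ∧
      -- transitively
      MulAction.IsPretransitive G (restrictedGrassmannian p Hp) ∧
      -- the stabilizer of `H₊` consists of all block diagonal pairs of unitaries of `H₊` and `H₋`
      ∃ (hmem : Hp ∈ restrictedGrassmannian p Hp)
        (e : MulAction.stabilizer G (⟨Hp, hmem⟩ : restrictedGrassmannian p Hp) ≃*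
          unitary (Hp.toSubmodule →L[ℂ] Hp.toSubmodule) ×
            unitary (Hp.orthogonal.toSubmodule →L[ℂ] Hp.orthogonal.toSubmodule)),
        ∀ g : MulAction.stabilizer G (⟨Hp, hmem⟩ : restrictedGrassmannian p Hp),
          (∀ x : Hp.toSubmodule, (((g : G) : unitary (H →L[ℂ] H)) : H →L[ℂ] H) x =
            ((e g).1 : Hp.toSubmodule →L[ℂ] Hp.toSubmodule) x) ∧
          (∀ y : Hp.orthogonal.toSubmodule, (((g : G) : unitary (H →L[ℂ] H)) : H →L[ℂ] H) y =
            ((e g).2 : Hp.orthogonal.toSubmodule →L[ℂ] Hp.orthogonal.toSubmodule) y) := by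
  have hp : 0 < p := by linarith
  have hmem := self_mem_restrictedGrassmannian hp hp2 Hp
  refine ⟨restrictedUnitarySubgroup hp hp2 Hp, rfl, restrictedAction hp hp2 Hp,
    fun g V => V.1.coe_unitaryImage g.1, ?_, hmem, ?_⟩
  · refine @MulAction.IsPretransitive.mk _ _ (restrictedAction hp hp2 Hp).toSMul fun V W => ?_
    obtain ⟨u, hu⟩ := exists_unitaryImage_eq (V := V.1) (W := W.1)
      (nonempty_linearIsometryEquiv_of_infinite
        (infinite_of_mem_restrictedGrassmannian hplus V.2)
        (infinite_of_mem_restrictedGrassmannian hplus W.2))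
      (nonempty_linearIsometryEquiv_of_infinite
        (infinite_of_mem_restrictedGrassmannian hminus
          (orthogonal_mem_restrictedGrassmannian hp hp2 V.2))
        (infinite_of_mem_restrictedGrassmannian hminus
          (orthogonal_mem_restrictedGrassmannian hp hp2 W.2)))
    -- The choice of isometries is irrelevant: any unitary between two members of the Grassmannian
    -- is restricted.
    exact ⟨⟨u, mem_restrictedUnitary_of_unitaryImage hp hp2 V.2 (hu ▸ W.2)⟩, Subtype.ext hu⟩
  · refine ⟨(stabilizerEquiv hp hp2 Hp).symm, fun g => ?_⟩
    obtain ⟨a, rfl⟩ := (stabilizerEquiv hp hp2 Hp).surjective g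
    rw [MulEquiv.symm_apply_apply]
    exact ⟨blockMap_apply_left a.1.1 a.2.1, blockMap_apply_right a.1.1 a.2.1⟩
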